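/- **Setting.** Let $F$ be a real Fréchet space with a sequence $(\|\cdot\|_n)_{n}$ of seminorms defining its topology, and let $M$ be a Hausdorff $C^k$-manifold modelled on $F$, $4\le k\le\infty$, where $C^k$ is meant in the sense of Michal–Bastiani: the iterated directional derivatives $d^jf(x)(h_1,\dots,h_j)$, $j\le k$, exist and are jointly continuous. Let $\tau\colon TM\to M$ and $\tau_2\colon T(TM)\to TM$ be the tangent bundles; write $f_*=Tf$ and $f_{**}=T(Tf)$. A *spray* of class $C^r$ ($1\le r$, $r+2\le k$) is a $C^r$-map $\mathsf S\colon TM\to T(TM)$ with $\tau_*\circ\mathsf S=\mathrm{id}_{TM}=\tau_2\circ\mathsf S$ and $\mathsf S(av)=(L_a)_*(a\,\mathsf S(v))$ for all $a\in\mathbb R$, $v\in TM$, where $L_a\colon TM\to TM$, $v\mapsto av$. A *geodesic* of $\mathsf S$ is a curve $g\colon I\to M$ on an open interval $I$ whose canonical lift $g'\colon I\to TM$ is an integral curve of $\mathsf S$, i.e. $g''=\mathsf S(g')$. For $A\subset F$ put $d_n(x,A)=\inf_{y\in A}\|x-y\|_n$. Let $S\subset M$ and $p\in S$. A vector $v\in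 T_pM$ is *adjacent tangent* to $S$ at $p$ if there is a $C^k$-chart $(U,\varphi)$ around $p$ such that $\lim_{t\to0^+}t^{-1}d_n(\varphi(p)+t\,d\varphi_p(v),\varphi(U\cap S))=0$ for all $n$. Given such a $v$, a vector $w\in T_v(TM)$ is *second-order adjacent tangent* to $S$ at $p$ if there is a $C^k$-chart $(U,\varphi)$ around $p$ such that, with $v_\varphi=d\varphi_p(v)$ and $d(\varphi_*)_v(w)=(w_1,w_2)\in F\times F$, one has $w_1=v_\varphi$ and $$\lim_{t\to0^+}t^{-2}d_n\big(\varphi(p)+t v_\varphi+\tfrac12t^2w_2,\ \varphi(U\cap S)\big)=0\quad\text{for all }n.$$ The set of these $w$ (over all such $v$) is $T^2_pS$. The *admissible set* is $A_{\mathsf S,S}=\{v\in TM:\tau(v)\in S,\ \mathsf S(v)\in T^2_{\tau(v)}S\}$. The set $S$ is *spray-invariant* with respect to $\mathsf S$ if $A_{\mathsf S,S}\neq\emptyset$ and every geodesic $g\colon I\to M$ of $\mathsf S$ with $0\in I$, $g(0)\in S$ and $g'(0)\in A_{\mathsf S,S}$ satisfies $g(t)\in S$ for all $t\in I$. An *automorphism*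 of $\mathsf S$ is a $C^k$-diffeomorphism $\phi\colon M\to M$ with $\phi_{**}\circ\mathsf S\circ\phi_*^{-1}=\mathsf S$. **Theorem.** Let $S\subset M$ be a non-empty closed subset that is spray-invariant with respect to a spray $\mathsf S$ on $M$, and let $\phi$ be an automorphism of $\mathsf S$. Then $\phi(S)$ is spray-invariant with respect to $\mathsf S$. -/

import Mathlib

open Set Filter Topology

set_option linter.unusedSectionVars false

namespace FrechetGeom

noncomputable section

/-! ### Differential calculus in the sense of Michal and Bastiani -/

section Calculus

variable {E F G : Type*}
  [AddCommGroup E] [Module ℝ E] [TopologicalSpace E]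
  [AddCommGroup F] [Module ℝ F] [TopologicalSpace F]
  [AddCommGroup G] [Module ℝ G] [TopologicalSpace G]

/-- `f` has the directional derivative `f'` at `x` in the direction `h`. -/
def HasDirDeriv (f : E → F) (f' : F) (x h : E) : Prop :=
  Tendsto (fun t : ℝ => t⁻¹ • (f (x + t • h) - f x)) (𝓝[≠] 0) (𝓝 f')

/-- The directional derivative `df(x)(h)`; meaningful where it exists. -/
def dirDeriv (f : E → F) (x h : E) : F :=
  limUnder (𝓝[≠] (0 : ℝ)) (fun t : ℝ => t⁻¹ • (f (x + t • h) - f x))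

/-- `f` is a `C^k`-mapping on the open set `U`: the iterated directional derivatives
`D j (x, (h₁, …, hⱼ)) = d^j f(x)(h₁, …, hⱼ)` exist for `j ≤ k`, `x ∈ U` and all directions, and each
of them is continuous on `U × E^j`. -/
def CkOn (k : ℕ∞) (f : E → F) (U : Set E) : Prop :=
  ∃ D : ∀ j : ℕ, E × (Fin j → E) → F,
    (∀ x ∈ U, ∀ h, D 0 (x, h) = f x) ∧
    (∀ j : ℕ, ((j + 1 : ℕ) : ℕ∞) ≤ k → ∀ x ∈ U, ∀ h : Fin (j + 1) → E,
      HasDirDeriv (fun y => D j (y, Fin.init h)) (D (j + 1) (x, h)) x (h (Fin.last j))) ∧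
    ∀ j : ℕ, (j : ℕ∞) ≤ k → ContinuousOn (D j) (U ×ˢ univ)

theorem HasDirDeriv.dirDeriv_eq [T2Space F] {f : E → F} {f' : F} {x h : E}
    (hf : HasDirDeriv f f' x h) : dirDeriv f x h = f' :=
  Tendsto.limUnder_eq hf

theorem CkOn.mono {k : ℕ∞} {f : E → F} {U V : Set E} (hf : CkOn k f U) (h : V ⊆ U) :
    CkOn k f V := by
  obtain ⟨D, h0, h1, h2⟩ := hf
  exact ⟨D, fun x hx => h0 x (h hx), fun j hj x hx => h1 j hj x (h hx),
    fun j hj => (h2 j hj).mono (prod_mono_left h)⟩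

theorem CkOn.congr {k : ℕ∞} {f g : E → F} {U : Set E} (hf : CkOn k f U)
    (h : ∀ x ∈ U, g x = f x) : CkOn k g U := by
  obtain ⟨D, h0, h1, h2⟩ := hf
  exact ⟨D, fun x hx v => (h0 x hx v).trans (h x hx).symm, h1, h2⟩

theorem HasDirDeriv.prodMk {f : E → F} {g : E → G} {f' : F} {g' : G} {x h : E}
    (hf : HasDirDeriv f f' x h) (hg : HasDirDeriv g g' x h) :
    HasDirDeriv (fun y => (f y, g y)) (f', g') x h :=
  Tendsto.prodMk_nhds hf hg

theorem CkOn.of_le {k m : ℕ∞} {f : E → F} {U : Set E} (hf : CkOn k f U) (h : m ≤ k) :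
    CkOn m f U := by
  obtain ⟨D, h0, h1, h2⟩ := hf
  exact ⟨D, h0, fun j hj => h1 j (hj.trans h), fun j hj => h2 j (hj.trans h)⟩

theorem CkOn.continuousOn {k : ℕ∞} {f : E → F} {U : Set E} (hf : CkOn k f U) :
    ContinuousOn f U := by
  obtain ⟨D, h0, -, h2⟩ := hf
  have : ContinuousOn (fun x => D 0 (x, 0)) U :=
    (h2 0 (by simp)).comp (by fun_prop) (fun x hx => ⟨hx, mem_univ _⟩)
  exact this.congr (fun x hx => (h0 x hx 0).symm)

variable [IsTopologicalAddGroup E] [ContinuousSMul ℝ E]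

theorem eventually_line (x h : E) {U : Set E} (hU : U ∈ 𝓝 x) :
    ∀ᶠ t : ℝ in 𝓝[≠] 0, x + t • h ∈ U := by
  have : Tendsto (fun t : ℝ => x + t • h) (𝓝 0) (𝓝 x) := by
    have : Continuous (fun t : ℝ => x + t • h) := by fun_prop
    simpa using this.tendsto 0
  exact (this.mono_left nhdsWithin_le_nhds).eventually hU

theorem HasDirDeriv.congr {f g : E → F} {f' : F} {x h : E} (hf : HasDirDeriv f f' x h)
    (hfg : g =ᶠ[𝓝 x] f) : HasDirDeriv g f' x h := by
  refine Tendsto.congr' ?_ hf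
  filter_upwards [eventually_line x h hfg] with t ht
  rw [hfg.eq_of_nhds, show g (x + t • h) = f (x + t • h) from ht]

theorem dirDeriv_congr {f g : E → F} {x : E} (hfg : g =ᶠ[𝓝 x] f) (h : E) :
    dirDeriv g x h = dirDeriv f x h := by
  unfold dirDeriv limUnder
  congr 1
  refine Filter.map_congr ?_
  filter_upwards [eventually_line x h hfg] with t ht
  rw [hfg.eq_of_nhds, show g (x + t • h) = f (x + t • h) from ht]

theorem CkOn.hasDirDeriv [T2Space F] {f : E → F} {U : Set E} (hU : IsOpen U)
    (hf : CkOn 1 f U) {x : E} (hx : x ∈ U) (h : E) : HasDirDeriv f (dirDeriv f x h) x h := by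
  obtain ⟨D, h0, h1, -⟩ := hf
  have := (h1 0 (by simp) x hx (fun _ => h)).congr (g := f) (by
    filter_upwards [hU.mem_nhds hx] with y hy using (h0 y hy _).symm)
  rwa [this.dirDeriv_eq]

theorem CkOn.continuousOn_dirDeriv [T2Space F] {f : E → F} {U : Set E} (hU : IsOpen U)
    (hf : CkOn 1 f U) : ContinuousOn (fun q : E × E => dirDeriv f q.1 q.2) (U ×ˢ univ) := by
  obtain ⟨D, h0, h1, h2⟩ := hf
  have hc : ContinuousOn (fun q : E × E => D 1 (q.1, fun _ => q.2)) (U ×ˢ univ) :=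
    (h2 1 (by simp)).comp (by fun_prop) (fun q hq => ⟨hq.1, mem_univ _⟩)
  refine hc.congr fun q hq => HasDirDeriv.dirDeriv_eq ?_
  exact (h1 0 (by simp) q.1 hq.1 (fun _ => q.2)).congr (g := f) (by
    filter_upwards [hU.mem_nhds hq.1] with y hy using (h0 y hy _).symm)

theorem CkOn.one_of_dirDeriv {f : E → F} {U : Set E} {D : E × E → F}
    (h1 : ∀ x ∈ U, ∀ h, HasDirDeriv f (D (x, h)) x h) (hf : ContinuousOn f U)
    (h2 : ContinuousOn D (U ×ˢ univ)) : CkOn 1 f U := by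
  refine ⟨fun j => match j with
    | 0 => fun q => f q.1
    | 1 => fun q => D (q.1, q.2 0)
    | _ + 2 => fun _ => 0, fun _ _ _ => rfl, ?_, ?_⟩
  · intro j hj x hx h
    have : j = 0 := by
      have : j + 1 ≤ 1 := by exact_mod_cast hj
      omega
    subst this
    exact h1 x hx (h 0)
  · intro j hj
    have hj : j ≤ 1 := by exact_mod_cast hj
    match j, hj with
    | 0, _ => exact hf.comp continuousOn_fst (fun q hq => hq.1)
    | 1, _ => exact h2.comp (by fun_prop) (fun q hq => ⟨hq.1, mem_univ _⟩)

/-- Difference quotients of a `C^1`-mapping along converging base points and directions. -/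
theorem CkOn.tendsto_slope [IsTopologicalAddGroup F] [ContinuousSMul ℝ F]
    [LocallyConvexSpace ℝ F] [T2Space F] {f : E → F} {U : Set E} (hU : IsOpen U)
    (hf : CkOn 1 f U) {x h : E} (hx : x ∈ U) {a b : ℝ → E}
    (ha : Tendsto a (𝓝[≠] 0) (𝓝 x)) (hb : Tendsto b (𝓝[≠] 0) (𝓝 h)) :
    Tendsto (fun t : ℝ => t⁻¹ • (f (a t + t • b t) - f (a t))) (𝓝[≠] 0)
      (𝓝 (dirDeriv f x h)) := by
  have hbasis : ∀ W ∈ 𝓝 (dirDeriv f x h), ∃ V ∈ 𝓝 (dirDeriv f x h),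
      IsClosed V ∧ Convex ℝ V ∧ V ⊆ W := by
    intro W hW
    obtain ⟨W', hW', hc, hsub⟩ := exists_mem_nhds_isClosed_subset hW
    obtain ⟨V, ⟨hV, hVc⟩, hVs⟩ :=
      (LocallyConvexSpace.convex_basis (𝕜 := ℝ) (dirDeriv f x h)).mem_iff.1 hW'
    exact ⟨closure V, mem_of_superset hV subset_closure, isClosed_closure, hVc.closure,
      (closure_minimal hVs hc).trans hsub⟩
  intro W hW
  obtain ⟨V, hV, hVc, hVx, hVW⟩ := hbasis W hW
  refine mem_of_superset ?_ (preimage_mono hVW)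
  have hcont := hf.continuousOn_dirDeriv hU
  have hev : ∀ᶠ q : E × E in 𝓝 (x, h), q.1 ∈ U ∧ dirDeriv f q.1 q.2 ∈ V := by
    have h1 : U ×ˢ (univ : Set E) ∈ 𝓝 (x, h) := prod_mem_nhds (hU.mem_nhds hx) univ_mem
    have h2 := (hcont.continuousAt h1).eventually hV
    filter_upwards [h1, h2] with q hq hq' using ⟨hq.1, hq'⟩
  have hK : ∀ᶠ z : ℝ × E × E in 𝓝 ((0 : ℝ), x, h), ∀ s ∈ Icc (0 : ℝ) 1,
      z.2.1 + (s * z.1) • z.2.2 ∈ U ∧ dirDeriv f (z.2.1 + (s * z.1) • z.2.2) z.2.2 ∈ V := by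
    refine isCompact_Icc.eventually_forall_of_forall_eventually fun s _ => ?_
    have hc : Continuous (fun z : (ℝ × E × E) × ℝ =>
        ((z.1.2.1 + (z.2 * z.1.1) • z.1.2.2, z.1.2.2) : E × E)) := by fun_prop
    have := hc.tendsto (((0 : ℝ), x, h), s)
    simp only [mul_zero, zero_smul, add_zero] at this
    exact this.eventually hev
  have hlim : Tendsto (fun t : ℝ => (t, a t, b t)) (𝓝[≠] 0) (𝓝 ((0 : ℝ), x, h)) :=
    (tendsto_id.mono_left nhdsWithin_le_nhds).prodMk_nhds (ha.prodMk_nhds hb)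
  rw [mem_map]
  filter_upwards [hlim.eventually hK, self_mem_nhdsWithin] with t ht ht0
  have ht0 : t ≠ 0 := ht0
  by_contra hq
  obtain ⟨l, u, hl, hu⟩ := geometric_hahn_banach_closed_point hVx hVc hq
  have hder : ∀ s ∈ Icc (0 : ℝ) 1, HasDerivAt (fun s : ℝ => l (f (a t + (s * t) • b t)))
      (l (dirDeriv f (a t + (s * t) • b t) (b t)) * t) s := by
    intro s hs
    have h1 := hf.hasDirDeriv hU (ht s hs).1 (b t)
    have h2 : HasDerivAt (fun r : ℝ => l (f (a t + r • b t)))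
        (l (dirDeriv f (a t + (s * t) • b t) (b t))) (s * t) := by
      rw [hasDerivAt_iff_tendsto_slope_zero]
      have := (l.continuous.tendsto _).comp h1
      refine this.congr fun r => ?_
      simp [add_smul, add_assoc]
    exact h2.comp s (by simpa using (hasDerivAt_id s).mul_const t)
  obtain ⟨c, hc, hce⟩ := exists_hasDerivAt_eq_slope
    (fun s : ℝ => l (f (a t + (s * t) • b t)))
    (fun s : ℝ => l (dirDeriv f (a t + (s * t) • b t) (b t)) * t) one_pos
    (fun s hs => (hder s hs).continuousAt.continuousWithinAt)
    (fun s hs => hder s (Ioo_subset_Icc_self hs))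
  have h3 := hl _ (ht c (Ioo_subset_Icc_self hc)).2
  simp only [one_mul, zero_mul, zero_smul, add_zero, sub_zero, div_one] at hce
  simp only [map_smul, map_sub, smul_eq_mul] at hu
  rw [← hce, mul_comm _ t, inv_mul_cancel_left₀ ht0] at hu
  exact lt_asymm h3 hu

theorem CkOn.dirDeriv_add [IsTopologicalAddGroup F] [ContinuousSMul ℝ F]
    [LocallyConvexSpace ℝ F] [T2Space F] {f : E → F} {U : Set E} (hU : IsOpen U)
    (hf : CkOn 1 f U) {x : E} (hx : x ∈ U) (h w : E) :
    dirDeriv f x (h + w) = dirDeriv f x h + dirDeriv f x w := by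
  have ha : Tendsto (fun t : ℝ => x + t • h) (𝓝[≠] 0) (𝓝 x) := by
    have : Continuous (fun t : ℝ => x + t • h) := by fun_prop
    simpa using (this.tendsto 0).mono_left nhdsWithin_le_nhds
  have h1 := hf.tendsto_slope hU hx ha (tendsto_const_nhds (x := w))
  have h2 := hf.hasDirDeriv hU hx h
  refine HasDirDeriv.dirDeriv_eq ((h2.add h1).congr fun t => ?_)
  rw [← smul_add, smul_add t h w, add_assoc]
  congr 1
  abel

/-- The chain rule. -/
theorem CkOn.hasDirDeriv_comp [IsTopologicalAddGroup F] [ContinuousSMul ℝ F]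
    [IsTopologicalAddGroup G] [ContinuousSMul ℝ G]
    [LocallyConvexSpace ℝ G] [T2Space G] {g : F → G} {V : Set F} (hV : IsOpen V)
    (hg : CkOn 1 g V) {f : E → F} {f' : F} {x h : E} (hx : f x ∈ V) (hf : HasDirDeriv f f' x h) :
    HasDirDeriv (g ∘ f) (dirDeriv g (f x) f') x h := by
  refine (hg.tendsto_slope hV hx (tendsto_const_nhds (x := f x)) hf).congr' ?_
  filter_upwards [self_mem_nhdsWithin] with t ht
  rw [smul_inv_smul₀ ht]
  simp

theorem CkOn.dirDeriv_smul [IsTopologicalAddGroup F] [ContinuousSMul ℝ F] [T2Space F]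
    {f : E → F} {U : Set E} (hU : IsOpen U)
    (hf : CkOn 1 f U) {x : E} (hx : x ∈ U) (w : E) {t : ℝ} (ht0 : t ≠ 0) :
    dirDeriv f x (t • w) = t • dirDeriv f x w := by
  refine HasDirDeriv.dirDeriv_eq ?_
  have h1 := hf.hasDirDeriv hU hx w
  have hs : Tendsto (fun s : ℝ => s * t) (𝓝[≠] 0) (𝓝[≠] 0) := by
    refine tendsto_nhdsWithin_iff.2 ⟨?_, ?_⟩
    · have : Continuous (fun s : ℝ => s * t) := by fun_prop
      simpa using (this.tendsto 0).mono_left nhdsWithin_le_nhds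
    · filter_upwards [self_mem_nhdsWithin] with s hs
      exact mul_ne_zero hs ht0
  refine ((Tendsto.comp h1 hs).const_smul t).congr fun s => ?_
  rw [Function.comp_apply, mul_smul, smul_smul, mul_inv_rev, mul_inv_cancel_left₀ ht0]

theorem tendsto_of_line {D : E × E → F} {U : Set E} (hD : ContinuousOn D (U ×ˢ univ))
    (hU : IsOpen U) {x h : E} (hx : x ∈ U) (w : E) :
    Tendsto (fun t : ℝ => D (x + t • h, w)) (𝓝[≠] 0) (𝓝 (D (x, w))) := by
  have c1 : ContinuousAt D (x, w) :=
    hD.continuousAt (prod_mem_nhds (hU.mem_nhds hx) univ_mem)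
  have c2 : Tendsto (fun t : ℝ => (x + t • h, w)) (𝓝[≠] 0) (𝓝 (x, w)) := by
    have : Continuous (fun t : ℝ => (x + t • h, w)) := by fun_prop
    simpa using (this.tendsto 0).mono_left nhdsWithin_le_nhds
  exact c1.tendsto.comp c2

theorem continuousOn_aux {D : E × E → F} {U : Set E} (hD : ContinuousOn D (U ×ˢ univ))
    {c : (E × E) × (E × E) → E} (hc : Continuous c) :
    ContinuousOn (fun z : (E × E) × (E × E) => D (z.1.1, c z)) ((U ×ˢ univ) ×ˢ univ) :=
  hD.comp (by fun_prop) (fun _ hz => ⟨hz.1.1, mem_univ _⟩)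

/-- The tangent map of a `C^2`-mapping is `C^1`. -/
theorem CkOn.tangent [IsTopologicalAddGroup F] [ContinuousSMul ℝ F]
    [LocallyConvexSpace ℝ F] [T2Space F] {f : E → F} {U : Set E} (hU : IsOpen U)
    (hf : CkOn 2 f U) :
    CkOn 1 (fun q : E × E => (f q.1, dirDeriv f q.1 q.2)) (U ×ˢ univ) := by
  have hf1 : CkOn 1 f U := hf.of_le (by norm_num)
  have hd := hf1.continuousOn_dirDeriv hU
  obtain ⟨D, h0, h1, h2⟩ := hf
  have hD1 : ∀ y ∈ U, ∀ v : Fin 1 → E, D 1 (y, v) = dirDeriv f y (v 0) := by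
    intro y hy v
    symm
    refine HasDirDeriv.dirDeriv_eq ((h1 0 (by norm_num) y hy v).congr (g := f) ?_)
    filter_upwards [hU.mem_nhds hy] with z hz using (h0 z hz _).symm
  have hsnd : ∀ q ∈ U ×ˢ (univ : Set E), ∀ w : E × E,
      HasDirDeriv (fun q : E × E => dirDeriv f q.1 q.2)
        (D 2 (q.1, ![q.2, w.1]) + dirDeriv f q.1 w.2) q w := by
    rintro ⟨x, v⟩ hq ⟨h, w⟩
    have hx : x ∈ U := hq.1
    have e1 : HasDirDeriv (fun y => dirDeriv f y v) (D 2 (x, ![v, h])) x h := by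
      refine HasDirDeriv.congr (h1 1 (by norm_num) x hx ![v, h]) ?_
      filter_upwards [hU.mem_nhds hx] with y hy
      rw [hD1 y hy]
      rfl
    have e2 : Tendsto (fun t : ℝ => dirDeriv f (x + t • h) w) (𝓝[≠] 0)
        (𝓝 (dirDeriv f x w)) := 
      tendsto_of_line (D := fun q : E × E => dirDeriv f q.1 q.2) hd hU hx w
    refine (e1.add e2).congr' ?_
    filter_upwards [eventually_line x h (hU.mem_nhds hx), self_mem_nhdsWithin] with t ht ht0
    have ht0 : t ≠ 0 := ht0
    have e3 := hf1.dirDeriv_smul hU ht w ht0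
    simp only [Prod.smul_mk, Prod.mk_add_mk]
    rw [hf1.dirDeriv_add hU ht, e3, smul_sub, smul_sub, smul_add, inv_smul_smul₀ ht0]
    abel
  refine CkOn.one_of_dirDeriv
    (D := fun z : (E × E) × (E × E) =>
      (dirDeriv f z.1.1 z.2.1, D 2 (z.1.1, ![z.1.2, z.2.1]) + dirDeriv f z.1.1 z.2.2)) ?_ ?_ ?_
  · intro q hq w
    have a1 : HasDirDeriv (fun q : E × E => f q.1) (dirDeriv f q.1 w.1) q w :=
      hf1.hasDirDeriv hU hq.1 w.1
    exact a1.prodMk (hsnd q hq w)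
  · exact (hf1.continuousOn.comp continuousOn_fst fun q hq => hq.1).prodMk hd
  · have b1 : ContinuousOn (fun z : (E × E) × (E × E) => dirDeriv f z.1.1 z.2.1)
        ((U ×ˢ univ) ×ˢ univ) :=
      continuousOn_aux (D := fun q : E × E => dirDeriv f q.1 q.2) hd (c := fun z => z.2.1) (by fun_prop)
    have b2 : ContinuousOn (fun z : (E × E) × (E × E) => dirDeriv f z.1.1 z.2.2)
        ((U ×ˢ univ) ×ˢ univ) :=
      continuousOn_aux (D := fun q : E × E => dirDeriv f q.1 q.2) hd (c := fun z => z.2.2) (by fun_prop)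
    have b3 : ContinuousOn (fun z : (E × E) × (E × E) => D 2 (z.1.1, ![z.1.2, z.2.1]))
        ((U ×ˢ univ) ×ˢ univ) := by
      refine (h2 2 le_rfl).comp (Continuous.continuousOn ?_) (fun z hz => ⟨hz.1.1, mem_univ _⟩)
      refine (by fun_prop : Continuous fun z : (E × E) × (E × E) => z.1.1).prodMk ?_
      refine continuous_pi fun i => ?_
      fin_cases i
      · simpa using (by fun_prop : Continuous fun z : (E × E) × (E × E) => z.1.2)
      · simpa using (by fun_prop : Continuous fun z : (E × E) × (E × E) => z.2.1)
    exact b1.prodMk (b3.add b2)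

end Calculus

/-! ### Manifolds modelled on locally convex spaces, and their tangent bundles -/

attribute [local irreducible] dirDeriv

section Manifold

/-- `M` is a `C^k`-manifold modelled on `F`: the transition maps of its atlas are `C^k`. -/
class CkManifold (k : ℕ∞) (F M : Type*) [AddCommGroup F] [Module ℝ F] [TopologicalSpace F]
    [TopologicalSpace M] [ChartedSpace F M] : Prop where
  compat : ∀ e ∈ atlas F M, ∀ e' ∈ atlas F M, CkOn k (e' ∘ e.symm) (e.symm.trans e').source

section Basic

variable {E F G M N : Type*}
  [AddCommGroup F] [Module ℝ F] [TopologicalSpace F]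
  [AddCommGroup G] [Module ℝ G] [TopologicalSpace G]
  [TopologicalSpace M] [ChartedSpace F M] [TopologicalSpace N] [ChartedSpace G N]

theorem CkManifold.of_le {k m : ℕ∞} (h : m ≤ k) (hM : CkManifold k F M) : CkManifold m F M :=
  ⟨fun e he e' he' => (hM.compat e he e' he').of_le h⟩

instance CkManifold.two_of_four [hM : CkManifold 4 F M] : CkManifold 2 F M :=
  hM.of_le (by norm_num)

instance CkManifold.one_of_two [hM : CkManifold 2 F M] : CkManifold 1 F M :=
  hM.of_le (by norm_num)

variable (F M) in
/-- The charts of the `C^k`-structure of `M`: all local homeomorphisms from `M` to the model space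
that are `C^k`-compatible with the given atlas. -/
def maxAtlas (k : ℕ∞) : Set (OpenPartialHomeomorph M F) :=
  {e | ∀ e' ∈ atlas F M, CkOn k (e' ∘ e.symm) (e.symm.trans e').source ∧
    CkOn k (e ∘ e'.symm) (e'.symm.trans e).source}

variable (F G) in
/-- `f : M → N` is of class `C^k`: it is continuous, and its local representation in all charts of
the `C^k`-structures of `M` and `N` is `C^k`. -/
def IsCkMap (k : ℕ∞) (f : M → N) : Prop :=
  Continuous f ∧ ∀ e ∈ maxAtlas F M k, ∀ e' ∈ maxAtlas G N k,
    CkOn k (e' ∘ f ∘ e.symm) (e.target ∩ e.symm ⁻¹' (f ⁻¹' e'.source))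

end Basic

section Tangent

variable {F G M N : Type*}
  [AddCommGroup F] [Module ℝ F] [TopologicalSpace F] [IsTopologicalAddGroup F]
  [ContinuousSMul ℝ F] [LocallyConvexSpace ℝ F] [T2Space F]
  [AddCommGroup G] [Module ℝ G] [TopologicalSpace G] [IsTopologicalAddGroup G]
  [ContinuousSMul ℝ G] [LocallyConvexSpace ℝ G] [T2Space G]
  [TopologicalSpace M] [ChartedSpace F M] [CkManifold 1 F M]
  [TopologicalSpace N] [ChartedSpace G N] [CkManifold 1 G N]

theorem dirDeriv_transition_comp {e₁ e₂ : OpenPartialHomeomorph M F} (he₁ : e₁ ∈ atlas F M)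
    (he₂ : e₂ ∈ atlas F M) {e₃ : OpenPartialHomeomorph M F} (he₃ : e₃ ∈ atlas F M)
    {x : M} (h₁ : x ∈ e₁.source) (h₂ : x ∈ e₂.source) (h₃ : x ∈ e₃.source) (v : F) :
    dirDeriv (e₃ ∘ e₂.symm) (e₂ x) (dirDeriv (e₂ ∘ e₁.symm) (e₁ x) v) =
      dirDeriv (e₃ ∘ e₁.symm) (e₁ x) v := by
  have c12 := CkManifold.compat (k := 1) e₁ he₁ e₂ he₂
  have c23 := CkManifold.compat (k := 1) e₂ he₂ e₃ he₃
  have m12 : e₁ x ∈ (e₁.symm.trans e₂).source := by simp [h₁, h₂]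
  have m23 : (e₂ ∘ e₁.symm) (e₁ x) ∈ (e₂.symm.trans e₃).source := by simp [h₁, h₂, h₃]
  have h := c23.hasDirDeriv_comp (e₂.symm.trans e₃).open_source m23
    (c12.hasDirDeriv (e₁.symm.trans e₂).open_source m12 v)
  have hx : (e₂ ∘ e₁.symm) (e₁ x) = e₂ x := by simp [h₁]
  rw [hx] at h
  symm
  refine HasDirDeriv.dirDeriv_eq (h.congr ?_)
  filter_upwards [(e₁.symm.trans e₂).open_source.mem_nhds m12] with y hy
  have : e₁.symm y ∈ e₂.source := by simpa using hy.2
  simp [this]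

theorem continuousOn_comp_chart (e : OpenPartialHomeomorph M F) {D : F × F → F} {U : Set F}
    (hD : ContinuousOn D (U ×ˢ univ)) {A : Set M} (hA : ∀ x ∈ A, x ∈ e.source ∧ e x ∈ U) :
    ContinuousOn (fun p : M × F => D (e p.1, p.2)) (A ×ˢ univ) :=
  hD.comp ((e.continuousOn.comp continuousOn_fst fun p hp => (hA p.1 hp.1).1).prodMk
    continuousOn_snd) fun p hp => ⟨(hA p.1 hp.1).2, mem_univ _⟩

variable (F M) in
/-- The cocycle of the tangent bundle: over two charts `i`, `j` the coordinate change is the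
derivative `d(j ∘ i⁻¹)`. -/
def tangentCore : FiberBundleCore (atlas F M) M F where
  baseSet i := i.1.source
  isOpen_baseSet i := i.1.open_source
  indexAt x := ⟨chartAt F x, chart_mem_atlas F x⟩
  mem_baseSet_at x := mem_chart_source F x
  coordChange i j x v := dirDeriv (j.1 ∘ i.1.symm) (i.1 x) v
  coordChange_self i x hx v := by
    have h0 : HasDirDeriv (fun y : F => y) v (i.1 x) v := by
      refine tendsto_const_nhds.congr' ?_
      filter_upwards [self_mem_nhdsWithin] with t ht
      rw [add_sub_cancel_left, inv_smul_smul₀ ht]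
    refine HasDirDeriv.dirDeriv_eq (h0.congr ?_)
    filter_upwards [i.1.open_target.mem_nhds (i.1.map_source hx)] with y hy
    exact i.1.right_inv hy
  continuousOn_coordChange i j := by
    have hc := (CkManifold.compat (k := 1) i.1 i.2 j.1 j.2).continuousOn_dirDeriv
      (i.1.symm.trans j.1).open_source
    have hm := continuousOn_comp_chart i.1 (D := fun q : F × F => dirDeriv (j.1 ∘ i.1.symm) q.1 q.2)
      hc (A := i.1.source ∩ j.1.source) (fun x hx => ⟨hx.1, by simp [hx.1, hx.2]⟩)
    exact hm
  coordChange_comp i j k x hx v :=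
    dirDeriv_transition_comp i.2 j.2 k.2 hx.1.1 hx.1.2 hx.2 v

variable (F M) in
/-- The tangent bundle `TM`. A point of it is a pair `⟨p, v⟩`, where `v : F` is the representative
of a tangent vector at `p` in the preferred chart `chartAt F p`. -/
abbrev TangentBdl : Type _ := (tangentCore F M).TotalSpace

instance (p : M) : AddCommGroup ((tangentCore F M).Fiber p) := inferInstanceAs (AddCommGroup F)

instance (p : M) : Module ℝ ((tangentCore F M).Fiber p) := inferInstanceAs (Module ℝ F)

/-- The chart `(p, v) ↦ (e p, de_p v)` of `TM` induced by a chart `e` of `M`. -/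
def tangentChart (e : atlas F M) : OpenPartialHomeomorph (TangentBdl F M) (F × F) :=
  ((tangentCore F M).localTriv e).toOpenPartialHomeomorph.trans
    (e.1.prod (OpenPartialHomeomorph.refl F))

theorem tangentChart_apply (e : atlas F M) (ξ : TangentBdl F M) :
    tangentChart e ξ = (e.1 ξ.proj,
      dirDeriv (e.1 ∘ (chartAt F ξ.proj).symm) (chartAt F ξ.proj ξ.proj) ξ.snd) := rfl

theorem tangentChart_source (e : atlas F M) :
    (tangentChart e).source = {ξ | ξ.proj ∈ e.1.source} := by
  ext ξ
  simp only [tangentChart, OpenPartialHomeomorph.trans_source,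
    OpenPartialHomeomorph.prod_source, OpenPartialHomeomorph.refl_source, mem_inter_iff,
    mem_preimage, mem_prod, mem_univ, and_true, mem_ofPred_eq]
  exact ⟨fun h => h.1, fun h => ⟨h, h⟩⟩

theorem tangentChart_symm_apply (e : atlas F M) (q : F × F) :
    (tangentChart e).symm q = ⟨e.1.symm q.1,
      dirDeriv (F := F) (chartAt F (e.1.symm q.1) ∘ e.1.symm) (e.1 (e.1.symm q.1)) q.2⟩ := rfl

instance : ChartedSpace (F × F) (TangentBdl F M) where
  atlas := range tangentChart
  chartAt ξ := tangentChart ⟨chartAt F ξ.proj, chart_mem_atlas F ξ.proj⟩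
  mem_chart_source ξ := by
    rw [tangentChart_source]
    exact mem_chart_source F ξ.proj
  chart_mem_atlas ξ := mem_range_self _

instance tangentBdl_ckManifold {F M : Type*}
    [AddCommGroup F] [Module ℝ F] [TopologicalSpace F] [IsTopologicalAddGroup F]
    [ContinuousSMul ℝ F] [LocallyConvexSpace ℝ F] [T2Space F]
    [TopologicalSpace M] [ChartedSpace F M] [CkManifold 2 F M] :
    CkManifold 1 (F × F) (TangentBdl F M) where
  compat := by
    rintro _ ⟨e, rfl⟩ _ ⟨e', rfl⟩
    have h := (CkManifold.compat (k := 2) e.1 e.2 e'.1 e'.2).tangent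
      (e.1.symm.trans e'.1).open_source
    have key : ∀ q ∈ ((tangentChart e).symm.trans (tangentChart e')).source,
        q.1 ∈ (e.1.symm.trans e'.1).source := by
      intro q hq
      rw [OpenPartialHomeomorph.trans_source, tangentChart_source] at hq
      have h1 : q ∈ (tangentChart e).target := hq.1
      have h2 : q.1 ∈ e.1.target := by
        simp only [tangentChart, OpenPartialHomeomorph.trans_target,
          OpenPartialHomeomorph.prod_target] at h1
        exact h1.1.1
      have h3 : e.1.symm q.1 ∈ e'.1.source := hq.2
      rw [OpenPartialHomeomorph.trans_source]
      exact ⟨h2, h3⟩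
    refine (h.mono (fun q hq => ⟨key q hq, mem_univ _⟩)).congr fun q hq => ?_
    have hq1 := key q hq
    have hq2 : e.1.symm q.1 ∈ e'.1.source := hq1.2
    have hq3 : e.1 (e.1.symm q.1) = q.1 := e.1.right_inv hq1.1
    have hq4 := dirDeriv_transition_comp e.2 (chart_mem_atlas F (e.1.symm q.1)) e'.2
      (e.1.map_target hq1.1) (mem_chart_source F _) hq2 q.2
    rw [hq3] at hq4
    rw [Function.comp_apply, tangentChart_symm_apply, tangentChart_apply]
    refine Prod.ext rfl ?_
    simp only [hq3]
    exact hq4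

/-- The tangent map `f_* : TM → TN` of `f : M → N`. -/
def tmap (f : M → N) : TangentBdl F M → TangentBdl G N := fun ξ =>
  ⟨f ξ.proj, dirDeriv (F := G) (chartAt G (f ξ.proj) ∘ f ∘ (chartAt F ξ.proj).symm)
    (chartAt F ξ.proj ξ.proj) ξ.snd⟩

/-- The tangent map `e_* : TM → G × G`, `(p, v) ↦ (e p, de_p v)`, of a map `e` from `M` (or an open
part of it) to a vector space `G`, the tangent bundle of `G` being identified with `G × G`. -/
def tcoord (e : M → G) : TangentBdl F M → G × G := fun ξ =>
  (e ξ.proj, dirDeriv (e ∘ (chartAt F ξ.proj).symm) (chartAt F ξ.proj ξ.proj) ξ.snd)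

/-- The fibrewise scalar multiplication `v ↦ a v` of the tangent bundle. -/
def fiberSMul (a : ℝ) : TangentBdl F M → TangentBdl F M := fun ξ =>
  ⟨ξ.proj, a • ξ.snd⟩

variable (F) in
/-- The velocity `c'(t) ∈ TM` of a curve `c` in `M`; meaningful where `c` is differentiable. -/
def velocity (c : ℝ → M) (t : ℝ) : TangentBdl F M :=
  ⟨c t, dirDeriv (F := F) (chartAt F (c t) ∘ c) t 1⟩

/-- The curve `c` in `M` is differentiable at `t`, with `c'(t) = ξ`. -/
def HasVelocity (c : ℝ → M) (t : ℝ) (ξ : TangentBdl F M) : Prop :=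
  ContinuousAt c t ∧ ξ.proj = c t ∧ HasDirDeriv (chartAt F ξ.proj ∘ c) ξ.snd t 1

end Tangent

end Manifold

/-! ### Sprays, adjacent cones and spray-invariant sets -/

section Spray

variable {F M : Type*}
  [AddCommGroup F] [Module ℝ F] [TopologicalSpace F] [IsTopologicalAddGroup F]
  [ContinuousSMul ℝ F] [LocallyConvexSpace ℝ F] [T2Space F]
  [TopologicalSpace M] [ChartedSpace F M] [CkManifold 4 F M]

variable (F M) in
/-- The double tangent bundle `T(TM)`. -/
abbrev DoubleTangentBdl : Type _ := TangentBdl (F × F) (TangentBdl F M)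

/-- A spray of class `C^r`: a symmetric second-order vector field `s : TM → T(TM)` of class `C^r`
with `s (a v) = (L_a)_* (a (s v))`, where `L_a` is the fibrewise multiplication by `a` on `TM`. -/
structure IsSpray (r : ℕ∞) (s : TangentBdl F M → DoubleTangentBdl F M) : Prop where
  ckMap : IsCkMap (F × F) ((F × F) × (F × F)) r s
  second_order : ∀ v, tmap (F := F × F) (G := F)
    (fun ξ : TangentBdl F M => ξ.proj) (s v) = v
  symmetric : ∀ v, (s v).proj = v
  homogeneous : ∀ (a : ℝ) (v : TangentBdl F M),
    s (fiberSMul a v) = tmap (fiberSMul a) (fiberSMul a (s v))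

/-- `g` is a geodesic of `s` on the open set `I`: its canonical lift `g'` exists on `I` and is an
integral curve of `s` there. (As `s` is continuous, `g` is then of class `C^2` on `I`.) -/
def IsGeodesicOn (s : TangentBdl F M → DoubleTangentBdl F M) (g : ℝ → M) (I : Set ℝ) : Prop :=
  (∀ t ∈ I, HasVelocity g t (velocity F g t)) ∧
    ∀ t ∈ I, HasVelocity (velocity F g) t (s (velocity F g t))

/-- The pseudo-distance of `x` to the set `A` with respect to the `n`-th seminorm. -/
def pseudoDist (q : ℕ → Seminorm ℝ F) (n : ℕ) (x : F) (A : Set F) : ℝ :=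
  sInf ((fun y => q n (x - y)) '' A)

/-- The adjacent cone `T_p S` to `S ⊆ M` at `p`, a set of tangent vectors at `p`. -/
def adjacentCone (q : ℕ → Seminorm ℝ F) (k : ℕ∞) (S : Set M) (p : M) : Set (TangentBdl F M) :=
  {v | v.proj = p ∧ p ∈ S ∧ ∃ e ∈ maxAtlas F M k, p ∈ e.source ∧
    ∀ n, Tendsto
      (fun t : ℝ => t⁻¹ * pseudoDist q n (e p + t • (tcoord e v).2) (e '' (e.source ∩ S)))
      (𝓝[>] 0) (𝓝 0)}

/-- The set `T²_p S` of second-order adjacent tangent vectors to `S ⊆ M` at `p`. For `w ∈ T_v(TM)`,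
with `v` an adjacent tangent vector at `p`, the local representation of `w` in a chart `e` is
`((e p, v_e), (w₁, w₂)) = tcoord (tcoord e) w`; it is required that `w₁ = v_e` and that the
pseudo-distances of `e p + t v_e + (t² / 2) w₂` to `e (U ∩ S)` are `o(t²)`. -/
def secondAdjacentCone (q : ℕ → Seminorm ℝ F) (k : ℕ∞) (S : Set M) (p : M) :
    Set (DoubleTangentBdl F M) :=
  {w | w.proj ∈ adjacentCone q k S p ∧ ∃ e ∈ maxAtlas F M k, p ∈ e.source ∧
    (tcoord (tcoord e) w).2.1 = (tcoord e w.proj).2 ∧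
    ∀ n, Tendsto
      (fun t : ℝ => (t ^ 2)⁻¹ * pseudoDist q n
        (e p + t • (tcoord e w.proj).2 + (t ^ 2 / 2) • (tcoord (tcoord e) w).2.2)
        (e '' (e.source ∩ S)))
      (𝓝[>] 0) (𝓝 0)}

/-- The admissible set `A_{s,S}`: all `v ∈ TM` based at a point `p` of `S` with `s v ∈ T²_p S`. -/
def admissibleSet (q : ℕ → Seminorm ℝ F) (k : ℕ∞) (s : TangentBdl F M → DoubleTangentBdl F M)
    (S : Set M) : Set (TangentBdl F M) :=
  {v | v.proj ∈ S ∧ s v ∈ secondAdjacentCone q k S v.proj}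

/-- `S` is spray-invariant with respect to `s`: the admissible set is non-empty, and every geodesic
of `s`, defined on an open interval around `0`, that starts in `S` with an admissible initial
velocity stays in `S`. -/
def IsSprayInvariant (q : ℕ → Seminorm ℝ F) (k : ℕ∞)
    (s : TangentBdl F M → DoubleTangentBdl F M) (S : Set M) : Prop :=
  (admissibleSet q k s S).Nonempty ∧
    ∀ (I : Set ℝ) (g : ℝ → M), IsOpen I → I.OrdConnected → (0 : ℝ) ∈ I → IsGeodesicOn s g I →
      g 0 ∈ S → velocity F g 0 ∈ admissibleSet q k s S → ∀ t ∈ I, g t ∈ S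

/-- `φ` is an automorphism of the spray `s`: a `C^k`-diffeomorphism of `M` such that
`φ_** ∘ s ∘ φ_*⁻¹ = s`. Here `φ_*⁻¹` is the tangent map of `φ⁻¹`. -/
structure IsSprayAut (k : ℕ∞) (s : TangentBdl F M → DoubleTangentBdl F M) (φ : M ≃ₜ M) :
    Prop where
  ckMap : IsCkMap F F k φ
  ckMap_symm : IsCkMap F F k φ.symm
  conj : tmap (tmap φ) ∘ s ∘ tmap φ.symm = s

end Spray

end

end FrechetGeom

open FrechetGeom

/-! Every notion entering spray-invariance is natural under diffeomorphisms preserving the spray. If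
`e` is a chart of the `C^k`-structure, so is `e ∘ φ⁻¹` (`trans_mem_maxAtlas`). By the chain rule,
`φ_* v` has the same coordinates in `e ∘ φ⁻¹` as `v` has in `e`, and likewise `φ_** w` and `w`;
moreover `e ∘ φ⁻¹` maps `φ(U) ∩ φ(S)` onto the same subset of `F` to which `e` maps `U ∩ S`. The
limits defining both tangent cones are therefore literally unchanged, and no estimate on the
seminorms is needed.

Since `s ∘ φ_* = φ_** ∘ s`, it follows that `φ_*` sends the admissible set of `S` into that of
`φ(S)` (`tmap_mem_admissibleSet`), and `φ` sends geodesics to geodesics (`isGeodesicOn_comp`). Both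
facts also hold for `φ⁻¹`, again an automorphism. A geodesic starting admissibly in `φ(S)` is thus
pulled back to one starting admissibly in `S`; the latter stays in `S`, so the former stays in
`φ(S)`.

Most of the work lies in the chain rules for `tmap` and `tcoord`, on `M` and once more on `TM`. -/

namespace FrechetGeom

/-! ### Chain rule for `C^1`-mappings between model spaces -/

section Calculus

variable {E F G : Type*}
  [AddCommGroup E] [Module ℝ E] [TopologicalSpace E] [IsTopologicalAddGroup E] [ContinuousSMul ℝ E]
  [AddCommGroup F] [Module ℝ F] [TopologicalSpace F] [IsTopologicalAddGroup F] [ContinuousSMul ℝ F]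
  [T2Space F]
  [AddCommGroup G] [Module ℝ G] [TopologicalSpace G] [IsTopologicalAddGroup G] [ContinuousSMul ℝ G]
  [LocallyConvexSpace ℝ G] [T2Space G]

/-- The chain rule for directional derivatives of mappings that agree near `x` with a composition
of `C^1`-mappings. -/
theorem dirDeriv_comp_eq {f : E → F} {g : F → G} {k : E → G} {U : Set E} {V : Set F}
    (hU : IsOpen U) (hV : IsOpen V) (hf : CkOn 1 f U) (hg : CkOn 1 g V) {x : E} (hx : x ∈ U)
    (hfx : f x ∈ V) (hk : k =ᶠ[𝓝 x] g ∘ f) (h : E) :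
    dirDeriv k x h = dirDeriv g (f x) (dirDeriv f x h) :=
  HasDirDeriv.dirDeriv_eq ((hg.hasDirDeriv_comp hV hfx (hf.hasDirDeriv hU hx h)).congr hk)

end Calculus

/-! ### Regularity tested in the given atlas -/

section Tangent

variable {F G H M N : Type*}
  [AddCommGroup F] [Module ℝ F] [TopologicalSpace F] [IsTopologicalAddGroup F]
  [ContinuousSMul ℝ F] [LocallyConvexSpace ℝ F] [T2Space F]
  [AddCommGroup G] [Module ℝ G] [TopologicalSpace G] [IsTopologicalAddGroup G]
  [ContinuousSMul ℝ G] [LocallyConvexSpace ℝ G] [T2Space G]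
  [AddCommGroup H] [Module ℝ H] [TopologicalSpace H] [IsTopologicalAddGroup H]
  [ContinuousSMul ℝ H] [LocallyConvexSpace ℝ H] [T2Space H]
  [TopologicalSpace M] [ChartedSpace F M] [TopologicalSpace N] [ChartedSpace G N]

variable (F G) in
/-- `f` is continuous, and its local representations in the charts of the given atlases are
`C^k`. -/
def IsCkInAtlas (k : ℕ∞) (f : M → N) : Prop :=
  Continuous f ∧ ∀ e ∈ atlas F M, ∀ e' ∈ atlas G N,
    CkOn k (e' ∘ f ∘ e.symm) (e.target ∩ e.symm ⁻¹' (f ⁻¹' e'.source))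

theorem IsCkInAtlas.of_le {k m : ℕ∞} {f : M → N} (hf : IsCkInAtlas F G k f) (h : m ≤ k) :
    IsCkInAtlas F G m f :=
  ⟨hf.1, fun e he e' he' => (hf.2 e he e' he').of_le h⟩

theorem CkManifold.atlas_subset_maxAtlas {k : ℕ∞} (hM : CkManifold k F M) :
    atlas F M ⊆ maxAtlas F M k :=
  fun e he e' he' => ⟨hM.compat e he e' he', hM.compat e' he' e he⟩

/-- Charts of the atlas are among the compatible ones. The weaker notion is the convenient one for
tangent maps, because it only has to be checked in the charts `tangentChart` of `TM`. -/
theorem IsCkMap.isCkInAtlas {k : ℕ∞} (hM : CkManifold k F M) (hN : CkManifold k G N) {f : M → N}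
    (hf : IsCkMap F G k f) : IsCkInAtlas F G k f :=
  ⟨hf.1, fun e he e' he' =>
    hf.2 e (hM.atlas_subset_maxAtlas he) e' (hN.atlas_subset_maxAtlas he')⟩

theorem isOpen_repr_domain (e : OpenPartialHomeomorph M F) (e' : OpenPartialHomeomorph N G)
    {f : M → N} (hf : Continuous f) : IsOpen (e.target ∩ e.symm ⁻¹' (f ⁻¹' e'.source)) :=
  e.isOpen_inter_preimage_symm (e'.open_source.preimage hf)

/-- Inserting `e₁⁻¹ ∘ e₁` is legitimate only on the domain of `e₁`, hence an equality of germs; this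
is all that directional derivatives see. -/
theorem repr_eventuallyEq (e : OpenPartialHomeomorph M F) {e₁ : OpenPartialHomeomorph M F}
    {α : Type*} (f : M → α) {p : M} (hp : p ∈ e.source) (hp₁ : p ∈ e₁.source) :
    f ∘ e.symm =ᶠ[𝓝 (e p)] (f ∘ e₁.symm) ∘ (e₁ ∘ e.symm) := by
  filter_upwards [(e.symm.trans e₁).open_source.mem_nhds
    (show e p ∈ (e.symm.trans e₁).source by simp [hp, hp₁])] with y hy
  have : e.symm y ∈ e₁.source := by simpa using hy.2
  simp [this]

/-! ### Tangent maps of `C^1`-maps: chain rule, functoriality, velocities -/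

section


/-- A vector-valued function is of class `C^1` near `p`, in the preferred chart at `p`. -/
def IsC1Near (G : Type*) [AddCommGroup G] [Module ℝ G] [TopologicalSpace G] [ChartedSpace G N]
    (g : N → H) (p : N) : Prop :=
  ∃ V, IsOpen V ∧ chartAt G p p ∈ V ∧ CkOn 1 (g ∘ (chartAt G p).symm) V

/-- Lets the chain rule be applied to charts outside the given atlas, such as `e ∘ φ⁻¹`. -/
theorem isC1Near_of_mem_maxAtlas {k : ℕ∞} (hk : 1 ≤ k) {e : OpenPartialHomeomorph M F}
    (he : e ∈ maxAtlas F M k) {p : M} (hp : p ∈ e.source) : IsC1Near F e p :=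
  ⟨_, ((chartAt F p).symm.trans e).open_source, by simp [hp],
    (he _ (chart_mem_atlas F p)).2.of_le hk⟩

theorem IsCkInAtlas.isC1Near {f : M → N} (hf : IsCkInAtlas F G 1 f)
    {e' : OpenPartialHomeomorph N G} (he' : e' ∈ atlas G N) {p : M} (hp : f p ∈ e'.source) :
    IsC1Near F (e' ∘ f) p :=
  ⟨_, isOpen_repr_domain (chartAt F p) e' hf.1, by simp [hp], hf.2 _ (chart_mem_atlas F p) _ he'⟩

variable [CkManifold 1 F M] [CkManifold 1 G N]

/-- The chain rule for `g_* ∘ f_*`. -/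
theorem tcoord_tmap {f : M → N} (hf : IsCkInAtlas F G 1 f) {g : N → H} {ξ : TangentBdl F M}
    (hg : IsC1Near G g (f ξ.proj)) : tcoord g (tmap (F := F) (G := G) f ξ) = tcoord (g ∘ f) ξ := by
  obtain ⟨V, hV, hpV, hgV⟩ := hg
  have hU := isOpen_repr_domain (chartAt F ξ.proj) (chartAt G (f ξ.proj)) hf.1
  have hpU : chartAt F ξ.proj ξ.proj ∈ (chartAt F ξ.proj).target ∩
      (chartAt F ξ.proj).symm ⁻¹' (f ⁻¹' (chartAt G (f ξ.proj)).source) := by simp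
  have h := dirDeriv_comp_eq (k := (g ∘ f) ∘ (chartAt F ξ.proj).symm) hU hV
    (hf.2 _ (chart_mem_atlas F _) _ (chart_mem_atlas G _)) hgV hpU (by simpa using hpV) (by
      filter_upwards [hU.mem_nhds hpU] with y hy
      have : f ((chartAt F ξ.proj).symm y) ∈ (chartAt G (f ξ.proj)).source := hy.2
      simp [this]) ξ.snd
  refine Prod.ext rfl ?_
  refine Eq.trans ?_ h.symm
  simp [tcoord, tmap]

/-- The chain rule for `k_*` in terms of the local representation of `k` in a chart. -/
theorem tcoord_eq_dirDeriv_chart {k : M → H} {e : OpenPartialHomeomorph M F} (he : e ∈ atlas F M)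
    {ξ : TangentBdl F M} (hp : ξ.proj ∈ e.source) {U : Set F} (hU : IsOpen U)
    (hk : CkOn 1 (k ∘ e.symm) U) (hpU : e ξ.proj ∈ U) :
    tcoord k ξ = (k ξ.proj, dirDeriv (k ∘ e.symm) (e ξ.proj) (tcoord e ξ).2) := by
  refine Prod.ext rfl ?_
  have h := dirDeriv_comp_eq (k := k ∘ (chartAt F ξ.proj).symm)
    ((chartAt F ξ.proj).symm.trans e).open_source hU
    (CkManifold.compat _ (chart_mem_atlas F _) e he) hk (x := chartAt F ξ.proj ξ.proj)
    (by simp [hp]) (by simpa using hpU)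
    (repr_eventuallyEq (chartAt F ξ.proj) k (mem_chart_source F _) hp) ξ.snd
  refine h.trans ?_
  simp [tcoord]

/-- Needed to apply `tcoord` twice: the inner maps `e_*` to be compared agree only over a chart
domain. -/
theorem tcoord_congr {k k' : M → H} {ξ : TangentBdl F M} (h : k =ᶠ[𝓝 ξ.proj] k') :
    tcoord k ξ = tcoord k' ξ := by
  refine Prod.ext h.eq_of_nhds (dirDeriv_congr ?_ _)
  have := (chartAt F ξ.proj).continuousAt_symm (mem_chart_target F ξ.proj)
  rw [ContinuousAt, (chartAt F ξ.proj).left_inv (mem_chart_source F _)] at this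
  exact this.eventually h

/-- Functoriality of the tangent map. -/
theorem tmap_comp {P : Type*} [TopologicalSpace P] [ChartedSpace H P] [CkManifold 1 H P]
    {f : M → N} {g : N → P} (hf : IsCkInAtlas F G 1 f) (hg : IsCkInAtlas G H 1 g)
    (ξ : TangentBdl F M) :
    tmap (F := G) (G := H) g (tmap (F := F) (G := G) f ξ) = tmap (F := F) (G := H) (g ∘ f) ξ := by
  -- With the preferred chart at `g (f p)` composed onto `g`, the second component of `tcoord` is by
  -- definition the fibre coordinate of `tmap`.
  have h := tcoord_tmap hf (ξ := ξ) (g := chartAt H (g (f ξ.proj)) ∘ g)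
    (hg.isC1Near (chart_mem_atlas H _) (mem_chart_source H _))
  exact congrArg (fun v : H × H =>
    (⟨g (f ξ.proj), (v.2 : H)⟩ : TangentBdl H P)) h

theorem tmap_id (ξ : TangentBdl F M) : tmap (F := F) (G := F) (id : M → M) ξ = ξ :=
  congrArg (fun v : F => (⟨ξ.proj, v⟩ : TangentBdl F M))
    ((tangentCore F M).coordChange_self ((tangentCore F M).indexAt ξ.proj) ξ.proj
      (mem_chart_source F ξ.proj) ξ.snd)

theorem HasVelocity.velocity_eq {c : ℝ → M} {t : ℝ} {ξ : TangentBdl F M} (h : HasVelocity c t ξ) :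
    velocity F c t = ξ := by
  obtain ⟨p, v⟩ := ξ
  obtain ⟨-, rfl, h⟩ := h
  exact congrArg (fun v : F => (⟨c t, v⟩ : TangentBdl F M)) h.dirDeriv_eq

theorem HasVelocity.congr {c c' : ℝ → M} {t : ℝ} {ξ : TangentBdl F M} (h : HasVelocity c t ξ)
    (hc : c' =ᶠ[𝓝 t] c) : HasVelocity c' t ξ :=
  ⟨h.1.congr hc.symm, h.2.1.trans hc.eq_of_nhds.symm, h.2.2.congr (hc.fun_comp _)⟩

/-- The chain rule in the preferred charts at `p` and `f p`. Continuity of `c` at `t` keeps the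
curve in the chart domain at nearby times, so that the inserted chart and its inverse cancel. -/
theorem HasVelocity.comp {f : M → N} (hf : IsCkInAtlas F G 1 f) {c : ℝ → M} {t : ℝ}
    {ξ : TangentBdl F M} (h : HasVelocity c t ξ) :
    HasVelocity (f ∘ c) t (tmap (F := F) (G := G) f ξ) := by
  obtain ⟨hc, hp, hd⟩ := h
  refine ⟨hf.1.continuousAt.comp hc, congrArg f hp, ?_⟩
  have hU := isOpen_repr_domain (chartAt F ξ.proj) (chartAt G (f ξ.proj)) hf.1
  have h := (hf.2 _ (chart_mem_atlas F ξ.proj) _ (chart_mem_atlas G (f ξ.proj))).hasDirDeriv_comp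
    hU (f := chartAt F ξ.proj ∘ c) (x := t) (by simp [← hp]) hd
  rw [Function.comp_apply, ← hp] at h
  refine h.congr ?_
  have hs : (chartAt F ξ.proj).source ∈ 𝓝 (c t) := hp ▸ chart_source_mem_nhds F ξ.proj
  filter_upwards [hc.eventually hs] with y hy
  have : c y ∈ (chartAt F ξ.proj).source := hy
  simp [tmap, this]

theorem tangentChart_target (e : atlas F M) : (tangentChart e).target = e.1.target ×ˢ univ := by
  ext q
  simp only [tangentChart, OpenPartialHomeomorph.trans_target, OpenPartialHomeomorph.prod_target,
    OpenPartialHomeomorph.refl_target, mem_inter_iff, mem_prod, mem_univ, and_true, mem_preimage]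
  exact ⟨fun h => h.1, fun h => ⟨h, e.1.map_target h, mem_univ _⟩⟩

end

/-! ### Tangent maps of `C^2`-maps -/

section

variable [CkManifold 2 F M] [CkManifold 2 G N]

/-- If `k` is of class `C^2`, then `k_*` is of class `C^1`. -/
theorem ckOn_tcoord_tangentChart_symm {k : M → H} (e : atlas F M) {U : Set F} (hU : IsOpen U)
    (hUe : U ⊆ e.1.target) (hk : CkOn 2 (k ∘ e.1.symm) U) :
    CkOn 1 (tcoord k ∘ (tangentChart e).symm) (U ×ˢ univ) := by
  refine (hk.tangent hU).congr fun q hq => ?_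
  have hqt : q ∈ (tangentChart e).target := by
    rw [tangentChart_target]
    exact ⟨hUe hq.1, mem_univ _⟩
  have hq1 : ((tangentChart e).symm q).proj ∈ e.1.source := e.1.map_target (hUe hq.1)
  have hq2 : e.1 ((tangentChart e).symm q).proj = q.1 := e.1.right_inv (hUe hq.1)
  -- On its domain `tangentChart e` is definitionally `tcoord e.1`.
  have hq3 : tcoord e.1 ((tangentChart e).symm q) = q := (tangentChart e).right_inv hqt
  rw [Function.comp_apply, tcoord_eq_dirDeriv_chart e.2 hq1 hU (hk.of_le (by norm_num))
    (by rw [hq2]; exact hq.1), hq3, hq2]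
  rfl

/-- The preferred chart of `TM` at `ξ` is induced by the preferred chart of `M` at its base point,
so the representation of `e_*` is the tangent map of a transition map, at the cost of one order of
differentiability. -/
theorem isC1Near_tcoord {k : ℕ∞} (hk : 2 ≤ k) {e : OpenPartialHomeomorph M F}
    (he : e ∈ maxAtlas F M k) {ξ : TangentBdl F M} (hp : ξ.proj ∈ e.source) :
    IsC1Near (F × F) (tcoord e) ξ := by
  have hU := ((chartAt F ξ.proj).symm.trans e).open_source
  refine ⟨((chartAt F ξ.proj).symm.trans e).source ×ˢ univ, hU.prod isOpen_univ,
    ⟨?_, mem_univ _⟩, ckOn_tcoord_tangentChart_symm ⟨chartAt F ξ.proj, chart_mem_atlas F _⟩ hU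
      (fun y hy => hy.1) ((he _ (chart_mem_atlas F _)).2.of_le hk)⟩
  change chartAt F ξ.proj ξ.proj ∈ _
  simp [hp]

/-- The tangent map of a `C^2`-map is of class `C^1`. -/
theorem IsCkInAtlas.tmap {f : M → N} (hf : IsCkInAtlas F G 2 f) :
    IsCkInAtlas (F × F) (G × G) 1 (tmap (F := F) (G := G) f) := by
  have hf1 : IsCkInAtlas F G 1 f := hf.of_le (by norm_num)
  -- In induced charts `f_*` reads as the tangent map of the local representation `e' ∘ f ∘ e⁻¹`.
  have key : ∀ (e : atlas F M) (e' : atlas G N),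
      CkOn 1 (tangentChart e' ∘ FrechetGeom.tmap (F := F) (G := G) f ∘ (tangentChart e).symm)
        ((e.1.target ∩ e.1.symm ⁻¹' (f ⁻¹' e'.1.source)) ×ˢ univ) := by
    intro e e'
    refine (ckOn_tcoord_tangentChart_symm (k := e'.1 ∘ f) e
      (isOpen_repr_domain e.1 e'.1 hf.1) inter_subset_left (hf.2 e.1 e.2 e'.1 e'.2)).congr ?_
    intro q hq
    refine tcoord_tmap hf1 (g := e'.1) (isC1Near_of_mem_maxAtlas le_rfl
      (CkManifold.atlas_subset_maxAtlas inferInstance e'.2) hq.1.2)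
  have hproj : Continuous fun ξ : TangentBdl F M => ξ.proj := (tangentCore F M).continuous_proj
  refine ⟨continuous_iff_continuousAt.2 fun ξ => ?_, ?_⟩
  · let e : atlas F M := ⟨chartAt F ξ.proj, chart_mem_atlas F _⟩
    let e' : atlas G N := ⟨chartAt G (f ξ.proj), chart_mem_atlas G _⟩
    have hξ : ξ ∈ (tangentChart e).source := by
      rw [tangentChart_source]
      exact mem_chart_source F ξ.proj
    have h1 : FrechetGeom.tmap (F := F) (G := G) f ⁻¹' (tangentChart e').source ∈ 𝓝 ξ := by
      rw [tangentChart_source]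
      exact (hf.1.comp hproj).continuousAt.preimage_mem_nhds
        (chart_source_mem_nhds G (f ξ.proj))
    -- Continuity of `f_*` is tested in induced charts, where it follows from `key`.
    rw [(tangentChart e').continuousAt_iff_continuousAt_comp_left h1,
      (tangentChart e).symm.continuousAt_iff_continuousAt_comp_right hξ]
    refine (key e e').continuousOn.continuousAt
      (((isOpen_repr_domain e.1 e'.1 hf.1).prod isOpen_univ).mem_nhds ⟨?_, mem_univ _⟩)
    change chartAt F ξ.proj ξ.proj ∈ _
    simp [e, e']
  · rintro _ ⟨e, rfl⟩ _ ⟨e', rfl⟩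
    refine (key e e').mono fun q hq => ⟨?_, mem_univ _⟩
    have h1 : q ∈ (tangentChart e).target := hq.1
    have h2 : FrechetGeom.tmap (F := F) (G := G) f ((tangentChart e).symm q) ∈
      (tangentChart e').source := hq.2
    rw [tangentChart_target] at h1
    rw [tangentChart_source] at h2
    exact ⟨h1.1, h2⟩

end

end Tangent

/-! ### Transport of charts, cones and geodesics by an automorphism -/

section Spray

variable {F M : Type*}
  [AddCommGroup F] [Module ℝ F] [TopologicalSpace F] [IsTopologicalAddGroup F]
  [ContinuousSMul ℝ F] [LocallyConvexSpace ℝ F] [T2Space F]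
  [TopologicalSpace M] [ChartedSpace F M] {k : ℕ∞}

/-- The two transition maps between `e ∘ φ⁻¹` and an atlas chart `e'` are `e' ∘ φ ∘ e⁻¹` and `e ∘
φ⁻¹ ∘ e'⁻¹`, local representations of `φ` and `φ⁻¹`. -/
theorem trans_mem_maxAtlas (hM : CkManifold k F M) {φ : M ≃ₜ M}
    (hφ : IsCkMap F F k φ) (hφ' : IsCkMap F F k φ.symm) {e : OpenPartialHomeomorph M F}
    (he : e ∈ maxAtlas F M k) :
    φ.symm.toOpenPartialHomeomorph.trans e ∈ maxAtlas F M k := by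
  intro e' he'
  have he'' := hM.atlas_subset_maxAtlas he'
  refine ⟨(hφ.2 e he e' he'').mono fun y hy => ?_, (hφ'.2 e' he'' e he).mono fun y hy => ?_⟩
  · simpa using hy
  · simpa using hy

variable [CkManifold 4 F M] {s : TangentBdl F M → DoubleTangentBdl F M} {φ : M ≃ₜ M}

theorem IsSprayAut.tmap_symm_tmap (hk : 4 ≤ k) (hM : CkManifold k F M) (hφ : IsSprayAut k s φ)
    (ξ : TangentBdl F M) : tmap (F := F) (G := F) φ.symm (tmap (F := F) (G := F) φ ξ) = ξ := by
  have h1 : (1 : ℕ∞) ≤ k := le_trans (by norm_num) hk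
  rw [tmap_comp ((hφ.ckMap.isCkInAtlas hM hM).of_le h1)
    ((hφ.ckMap_symm.isCkInAtlas hM hM).of_le h1), φ.symm_comp_self, tmap_id]

theorem IsSprayAut.isCkInAtlas_tmap (hk : 4 ≤ k) (hM : CkManifold k F M)
    (hφ : IsSprayAut k s φ) :
    IsCkInAtlas (F × F) (F × F) 1 (tmap (F := F) (G := F) φ) :=
  ((hφ.ckMap.isCkInAtlas hM hM).of_le (le_trans (by norm_num) hk)).tmap

theorem IsSprayAut.isCkInAtlas_tmap_symm (hk : 4 ≤ k) (hM : CkManifold k F M)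
    (hφ : IsSprayAut k s φ) :
    IsCkInAtlas (F × F) (F × F) 1 (tmap (F := F) (G := F) φ.symm) :=
  ((hφ.ckMap_symm.isCkInAtlas hM hM).of_le (le_trans (by norm_num) hk)).tmap

/-- An automorphism relates the spray to itself. -/
theorem IsSprayAut.apply_tmap (hk : 4 ≤ k) (hM : CkManifold k F M) (hφ : IsSprayAut k s φ)
    (ξ : TangentBdl F M) :
    s (tmap (F := F) (G := F) φ ξ) =
      tmap (F := F × F) (G := F × F) (tmap (F := F) (G := F) φ) (s ξ) := by
  -- The conjugation identity is evaluated at `φ_* ξ`, where `φ_*⁻¹` cancels.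
  conv_lhs => rw [← hφ.conj]
  simp only [Function.comp_apply]
  rw [hφ.tmap_symm_tmap hk hM]

theorem IsSprayAut.symm (hk : 4 ≤ k) (hM : CkManifold k F M) (hφ : IsSprayAut k s φ) :
    IsSprayAut k s φ.symm := by
  refine ⟨hφ.ckMap_symm, hφ.ckMap, funext fun ξ => ?_⟩
  simp only [Function.comp_apply, Homeomorph.symm_symm]
  rw [hφ.apply_tmap hk hM, tmap_comp (hφ.isCkInAtlas_tmap hk hM) (hφ.isCkInAtlas_tmap_symm hk hM),
    show tmap (F := F) (G := F) φ.symm ∘ tmap (F := F) (G := F) φ = id from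
      funext (hφ.tmap_symm_tmap hk hM), tmap_id]

theorem image_trans_chart (e : OpenPartialHomeomorph M F) (S : Set M) :
    φ.symm.toOpenPartialHomeomorph.trans e ''
      ((φ.symm.toOpenPartialHomeomorph.trans e).source ∩ φ '' S) = e '' (e.source ∩ S) := by
  ext y
  constructor
  · rintro ⟨_, ⟨hx, x, hxS, rfl⟩, rfl⟩
    exact ⟨x, ⟨by simpa using hx, hxS⟩, by simp⟩
  · rintro ⟨x, ⟨hx, hxS⟩, rfl⟩
    exact ⟨φ x, ⟨by simpa using hx, x, hxS, rfl⟩, by simp⟩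

/-- This is `(e ∘ φ⁻¹)_* ∘ φ_* = e_*`. -/
theorem IsSprayAut.tcoord_trans_tmap (hk : 4 ≤ k) (hM : CkManifold k F M)
    (hφ : IsSprayAut k s φ) {e : OpenPartialHomeomorph M F} (he : e ∈ maxAtlas F M k)
    {ξ : TangentBdl F M} (hp : ξ.proj ∈ e.source) :
    tcoord (φ.symm.toOpenPartialHomeomorph.trans e) (tmap (F := F) (G := F) φ ξ) = tcoord e ξ := by
  have h1 : (1 : ℕ∞) ≤ k := le_trans (by norm_num) hk
  rw [tcoord_tmap ((hφ.ckMap.isCkInAtlas hM hM).of_le h1) (isC1Near_of_mem_maxAtlas h1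
    (trans_mem_maxAtlas hM hφ.ckMap hφ.ckMap_symm he) (by simpa using hp))]
  congr 1
  ext x
  simp

theorem IsSprayAut.tcoord_tcoord_trans_tmap_tmap (hk : 4 ≤ k) (hM : CkManifold k F M)
    (hφ : IsSprayAut k s φ) {e : OpenPartialHomeomorph M F} (he : e ∈ maxAtlas F M k)
    {w : DoubleTangentBdl F M} (hp : w.proj.proj ∈ e.source) :
    tcoord (tcoord (φ.symm.toOpenPartialHomeomorph.trans e))
      (tmap (F := F × F) (G := F × F) (tmap (F := F) (G := F) φ) w) = tcoord (tcoord e) w := by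
  rw [tcoord_tmap (hφ.isCkInAtlas_tmap hk hM) (isC1Near_tcoord (le_trans (by norm_num) hk)
    (trans_mem_maxAtlas hM hφ.ckMap hφ.ckMap_symm he) (by simpa [tmap] using hp))]
  -- What remains is the first-order identity, valid on the open set of vectors based in the domain
  -- of `e`; a neighbourhood of `w.proj` suffices.
  refine tcoord_congr ?_
  have hproj : Continuous fun ξ : TangentBdl F M => ξ.proj := (tangentCore F M).continuous_proj
  filter_upwards [(e.open_source.preimage hproj).mem_nhds hp] with ξ hξ
  exact hφ.tcoord_trans_tmap hk hM he hξ

/-- If `e` witnesses tangency of `v`, then `e ∘ φ⁻¹` witnesses that of `φ_* v`. As the cone asks for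
a single chart, independence of the chart plays no role. -/
theorem IsSprayAut.tmap_mem_adjacentCone (hk : 4 ≤ k) (hM : CkManifold k F M)
    (hφ : IsSprayAut k s φ) {q : ℕ → Seminorm ℝ F} {S : Set M} {p : M} {v : TangentBdl F M}
    (hv : v ∈ adjacentCone q k S p) :
    tmap (F := F) (G := F) φ v ∈ adjacentCone q k (φ '' S) (φ p) := by
  obtain ⟨rfl, hpS, e, he, hpe, hlim⟩ := hv
  refine ⟨rfl, mem_image_of_mem φ hpS, _, trans_mem_maxAtlas hM hφ.ckMap hφ.ckMap_symm he,
    by simpa using hpe, fun n => ?_⟩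
  rw [hφ.tcoord_trans_tmap hk hM he hpe, image_trans_chart]
  simpa using hlim n

theorem IsSprayAut.tmap_tmap_mem_secondAdjacentCone (hk : 4 ≤ k) (hM : CkManifold k F M)
    (hφ : IsSprayAut k s φ) {q : ℕ → Seminorm ℝ F} {S : Set M} {p : M}
    {w : DoubleTangentBdl F M} (hw : w ∈ secondAdjacentCone q k S p) :
    tmap (F := F × F) (G := F × F) (tmap (F := F) (G := F) φ) w ∈
      secondAdjacentCone q k (φ '' S) (φ p) := by
  obtain ⟨hv, e, he, hpe, hw1, hlim⟩ := hw
  have hp : w.proj.proj ∈ e.source := hv.1 ▸ hpe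
  have h1 := hφ.tcoord_trans_tmap hk hM he hp
  have h2 := hφ.tcoord_tcoord_trans_tmap_tmap hk hM he hp
  refine ⟨hφ.tmap_mem_adjacentCone hk hM hv, _, trans_mem_maxAtlas hM hφ.ckMap hφ.ckMap_symm he,
    by simpa using hpe, ?_, fun n => ?_⟩
  · rw [h2]
    exact hw1.trans (congrArg Prod.snd h1).symm
  · rw [h2, image_trans_chart]
    have h3 : (tcoord (φ.symm.toOpenPartialHomeomorph.trans e)
        (tmap (F := F × F) (G := F × F) (tmap (F := F) (G := F) φ) w).proj).2 =
        (tcoord e w.proj).2 := congrArg Prod.snd h1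
    rw [h3]
    simpa using hlim n

theorem IsSprayAut.tmap_mem_admissibleSet (hk : 4 ≤ k) (hM : CkManifold k F M)
    (hφ : IsSprayAut k s φ) {q : ℕ → Seminorm ℝ F} {S : Set M} {v : TangentBdl F M}
    (hv : v ∈ admissibleSet q k s S) :
    tmap (F := F) (G := F) φ v ∈ admissibleSet q k s (φ '' S) := by
  refine ⟨mem_image_of_mem φ hv.1, ?_⟩
  rw [hφ.apply_tmap hk hM]
  exact hφ.tmap_tmap_mem_secondAdjacentCone hk hM hv.2

/-- Automorphisms of a spray map geodesics to geodesics. -/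
theorem IsSprayAut.isGeodesicOn_comp (hk : 4 ≤ k) (hM : CkManifold k F M)
    (hφ : IsSprayAut k s φ) {g : ℝ → M} {I : Set ℝ} (hI : IsOpen I) (hg : IsGeodesicOn s g I) :
    IsGeodesicOn s (φ ∘ g) I ∧
      ∀ t ∈ I, velocity F (φ ∘ g) t = tmap (F := F) (G := F) φ (velocity F g t) := by
  have hf : IsCkInAtlas F F 1 φ :=
    (hφ.ckMap.isCkInAtlas hM hM).of_le (le_trans (by norm_num) hk)
  have hv : ∀ t ∈ I, velocity F (φ ∘ g) t = tmap (F := F) (G := F) φ (velocity F g t) :=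
    fun t ht => ((hg.1 t ht).comp hf).velocity_eq
  refine ⟨⟨fun t ht => ?_, fun t ht => ?_⟩, hv⟩
  · rw [hv t ht]
    exact (hg.1 t ht).comp hf
  · rw [hv t ht, hφ.apply_tmap hk hM]
    refine ((hg.2 t ht).comp (hφ.isCkInAtlas_tmap hk hM)).congr ?_
    -- The second velocity depends on the germ of the lifted curve; openness of `I` gives the
    -- formula for the lift at all nearby times.
    filter_upwards [hI.mem_nhds ht] with y hy using hv y hy

end Spray

end FrechetGeom

/-! ### Invariance of the image -/

theorem theorem2p4 {F M : Type*}
    [AddCommGroup F] [Module ℝ F] [UniformSpace F] [IsUniformAddGroup F] [ContinuousSMul ℝ F]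
    [LocallyConvexSpace ℝ F] [CompleteSpace F] [T2Space F]
    (q : ℕ → Seminorm ℝ F) (hq : WithSeminorms q)
    [TopologicalSpace M] [T2Space M] [ChartedSpace F M] [CkManifold 4 F M]
    (k r : ℕ∞) (hk : 4 ≤ k) (hM : CkManifold k F M) (hr : 1 ≤ r) (hrk : r + 2 ≤ k)
    (s : TangentBdl F M → DoubleTangentBdl F M) (hs : IsSpray r s)
    (S : Set M) (hne : S.Nonempty) (hcl : IsClosed S) (hinv : IsSprayInvariant q k s S)
    (φ : M ≃ₜ M) (hφ : IsSprayAut k s φ) :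
    IsSprayInvariant q k s (φ '' S) := by
  obtain ⟨⟨v, hv⟩, hgeo⟩ := hinv
  refine ⟨⟨_, hφ.tmap_mem_admissibleSet hk hM hv⟩, ?_⟩
  intro I g hI hIc h0 hg hg0 hg0' t ht
  have hψ := hφ.symm hk hM
  obtain ⟨hψg, hvel⟩ := hψ.isGeodesicOn_comp hk hM hI hg
  have hS : φ.symm '' (φ '' S) = S := by simp [image_image]
  -- Transport by `φ⁻¹` from `φ(S)` lands in the admissible set of `φ⁻¹(φ(S)) = S`.
  have h1 := hψ.tmap_mem_admissibleSet hk hM hg0'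
  rw [hS, ← hvel 0 h0] at h1
  -- The base point of the pulled-back initial velocity is `φ⁻¹(g 0)`, so `h1.1` also says that the
  -- pulled-back geodesic starts in `S`.
  exact ⟨_, hgeo I _ hI hIc h0 hψg h1.1 h1 t ht, φ.apply_symm_apply _⟩
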